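/- **Setting.** Let $L\ge 2$ nodes form a directed graph without self-loops. $\mathcal N[l]$ denotes the set of nodes with an edge to $l$, and the graph is called balanced if every node has as many incoming as outgoing edges (for example, if it is undirected). Let $X$ be a real random variable with $\mathbb E[X^2]<\infty$. For each node $l$ let $W[l]$ be a real random variable, $\delta[l]>0$, $g[l]$ a measurement function, and $f_{\rm out}[l](\theta,y;v)$, $f_{\rm in}[l](u;\eta,\sigma^2)$ an outer and an inner denoiser (in particular they may be piecewise Lipschitz). An *aggregation protocol* $P$ maps a family $(a[l])_l$ to a family $(P(a)[l])_l$. For $T=1$ (consensus in every iteration), one iteration of the state evolution recursion with protocol $P$ is as follows. Given $\mathbb E[Z[l]Z_t[l]]$, $\mathbb E[Z_t^2[l]]$ and $\bar v_t[l]$, let $(Z[l],Z_t[l])$ be zero-mean Gaussian with these covariances and $\mathbb E[Z^2[l]]=\mathbb E[X^2]/(L\delta[l])$, independent of $W[l]$. Put $Y[l]=g[l](Z[l],W[l])$, $M_t[l]=f_{\rm out}[l](Z_t[l],Y[l];\bar v_t[l])$ and $$\bar\xi_t[l]=\mathbb E[\partial_1 f_{\rm out}[l](Z_t[l],Y[l];\bar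 v_t[l])],\qquad \bar\zeta_t[l]=-\mathbb E\big[\partial_z f_{\rm out}[l](Z_t[l],g[l](z,W[l]);\bar v_t[l])|_{z=Z[l]}\big].$$ Let $H_t[l]\sim\mathcal N(0,\mathbb E[M_t^2[l]]/L)$ be independent over $l$ and independent of $X$, and set $$\bar\eta_t[l]=P\big(\bar\zeta_t/\bar\xi_t\big)[l],\qquad \tilde H_t[l]=P\big(H_t/\bar\xi_t\big)[l],\qquad \bar\Sigma_t[l]=\mathbb E[\tilde H_t^2[l]].$$ With $U_t[l]=\frac{\bar\eta_t[l]}{L}X+\tilde H_t[l]$, the next variables are $$\mathbb E[Z[l]Z_{t+1}[l]]=\tfrac{1}{L\delta[l]}\mathbb E[Xf_{\rm in}[l](U_t[l];\eta_t[l],\bar\sigma_t^2[l])],\quad \mathbb E[Z_{t+1}^2[l]]=\tfrac{1}{L\delta[l]}\mathbb E[f_{\rm in}[l](U_t[l];\eta_t[l],\bar\sigma_t^2[l])^2],$$ $$\bar v_{t+1}[l]=\frac{\bar\sigma_t^2[l]}{\delta[l]\eta_t[l]}\mathbb E[\partial_1 f_{\rm in}[l](U_t[l];\eta_t[l],\bar\sigma_t^2[l])].$$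 *Centralized GAMP* uses $P(a)[l]=\sum_{l'}a[l']$, $\eta_t[l]=L$ and $\bar\sigma_t^2[l]=L^{-1}\sum_{l'}\bar\xi_t^{-1}[l']$. *D-GAMP with the linear protocol*, i.e. with $\tilde{\boldsymbol x}_t[l]=\boldsymbol x_t[l]+\gamma\sum_{l'\in\mathcal N[l]}(\boldsymbol x_t[l']-\boldsymbol x_t[l])$, $\gamma>0$, uses $P(a)[l]=a[l]+\gamma\sum_{l'\in\mathcal N[l]}(a[l']-a[l])$. Its parameters $\eta_t[l]$ and $\bar\sigma_t^2[l]$ may be computed by any rule with memory from the local values $1$ and $\bar\xi_t^{-1}[l]$ respectively, with an additional factor $L^{-1}$ for $\bar\sigma_t^2$ (for instance consensus propagation, or the linear protocol itself). A *fixed point* is the tuple $(\mathbb E[Z[l]Z_*[l]],\mathbb E[Z_*^2[l]],\bar v_*[l],\bar\eta_*[l],\bar\Sigma_*[l])_{l}$ of a stationary state. It is called nondegenerate if $\bar\eta_*[l]\ne0$ and $\bar\Sigma_*[l]\neq 0$ for some $l$. The effective SNR of node $l$ is $L^{-2}\bar\eta^2[l]/\bar\Sigma[l]$. **Theorem.**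 Let $\gamma>0$. 1. Suppose that the graph is balanced, or that $\gamma|\mathcal N[l]|<1$ for all $l$. Then no nondegenerate fixed point for centralized GAMP is a fixed point for D-GAMP with the linear protocol, whatever rule is used for $\eta_t$ and $\bar\sigma^2_t$. 2. Suppose that the measurements are homogeneous, i.e. $\delta[l]$, the law of $W[l]$, $g[l]$, $f_{\rm out}[l]$ and $f_{\rm in}[l]$ do not depend on $l$. Then for every nondegenerate fixed point for centralized GAMP, and for every node $l$, the effective SNR that the linear protocol yields from the same outer-module variables is at most the centralized one. Equality holds if and only if $\gamma=1/L$ and $\mathcal N[l]$ contains all nodes other than $l$. 3. Suppose that the graph is balanced and that $\gamma\ne1/L$ or the graph is not complete. Then for every nondegenerate fixed point for centralized GAMP at which $\bar\zeta_*[l]/\bar\xi_*[l]$ does not depend on $l$ and $\mathbb E[M_*^2[l]]>0$ for all $l$, there is a node at which the linear protocol yields, from the same outer-module variables, an effective SNR strictly smaller than the centralized one. -/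

import Mathlib

open MeasureTheory ProbabilityTheory

noncomputable section

namespace DGAMP

/-! ### Network and protocols -/

open Classical in
/-- Incoming neighborhood of node `l`: the nodes with an edge to `l`. -/
def inNbr {L : ℕ} (G : Digraph (Fin L)) (l : Fin L) : Finset (Fin L) :=
  Finset.univ.filter (fun k => G.Adj k l)

open Classical in
/-- Outgoing neighborhood of node `l`: the nodes with an edge from `l`. -/
def outNbr {L : ℕ} (G : Digraph (Fin L)) (l : Fin L) : Finset (Fin L) :=
  Finset.univ.filter (fun k => G.Adj l k)

/-- Every node has as many incoming as outgoing edges. Undirected graphs are balanced. -/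
def Balanced {L : ℕ} (G : Digraph (Fin L)) : Prop :=
  ∀ l, (inNbr G l).card = (outNbr G l).card

/-- A memoryless way of combining one number per node into one number per node.
Vectors are combined entry by entry. -/
abbrev Protocol (L : ℕ) := (Fin L → ℝ) → Fin L → ℝ

/-- The linear protocol `x l + γ * ∑_{k ∈ N[l]} (x k - x l)`. -/
def linearProtocol {L : ℕ} (G : Digraph (Fin L)) (γ : ℝ) : Protocol L :=
  fun x l => x l + γ * ∑ k ∈ inNbr G l, (x k - x l)

/-- Centralized aggregation: every node obtains the sum over all nodes. -/
def sumProtocol (L : ℕ) : Protocol L := fun x _ => ∑ k, x k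

/-- A rule, possibly with memory, by which the nodes compute the deterministic parameters `η`
and `σ²` of the inner denoiser from one local value per node. In each iteration the memory is
updated, and the updated memory is read out. -/
structure AuxRule (L : ℕ) where
  Mem : Type
  update : (Fin L → ℝ) → Mem → Mem
  read : (Fin L → ℝ) → Mem → Fin L → ℝ

/-- The memoryless rule given by a protocol. -/
def AuxRule.ofProtocol {L : ℕ} (P : Protocol L) : AuxRule L where
  Mem := Unit
  update := fun _ u => u
  read := fun a _ => P a

/-- Consensus propagation with `J` inner iterations. The memory holds the messages `u k l` sent
from node `k` to node `l`; the messages of one iteration are the initial ones of the next. -/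
def AuxRule.consensusPropagation {L : ℕ} (G : Digraph (Fin L)) (J : ℕ) : AuxRule L where
  Mem := Fin L → Fin L → ℝ
  update := fun a u =>
    (fun (w : Fin L → Fin L → ℝ) l l' => a l + ∑ k ∈ (inNbr G l).erase l', w k l)^[J] u
  read := fun a u l => a l + ∑ k ∈ inNbr G l, u k l

/-! ### State evolution -/

/-- The data of the measurement model and of the algorithm in the large system limit. -/
structure Model (L : ℕ) where
  /-- the law of the signal variable `X` -/
  lawX : Measure ℝ
  isProbX : IsProbabilityMeasure lawX
  memX : MemLp (fun x : ℝ => x) 2 lawX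
  /-- the law of the noise variable `W[l]` -/
  lawW : Fin L → Measure ℝ
  isProbW : ∀ l, IsProbabilityMeasure (lawW l)
  /-- the ratio of the number of measurements in node `l` to the signal dimension -/
  δ : Fin L → ℝ
  δ_pos : ∀ l, 0 < δ l
  /-- the measurement function `g[l](z, w)` -/
  g : Fin L → ℝ → ℝ → ℝ
  /-- the outer denoiser `f_out[l](θ, y; v)` -/
  fOut : Fin L → ℝ → ℝ → ℝ → ℝ
  /-- the inner denoiser `f_in[l](u; η, σ²)` -/
  fIn : Fin L → ℝ → ℝ → ℝ → ℝ

/-- The variables passed from the inner to the outer module: `zz l = E[Z[l] Z_t[l]]`,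
`z2 l = E[Z_t[l]^2]` and the parameter `v l` of the outer denoiser. -/
@[ext] structure OuterVars (L : ℕ) where
  zz : Fin L → ℝ
  z2 : Fin L → ℝ
  v : Fin L → ℝ

/-- All variables of a fixed point that are compared: those of the outer module together with the
effective amplitude `etaBar` and the effective noise power `SigmaBar` of the inner module. -/
@[ext] structure Vars (L : ℕ) extends OuterVars L where
  etaBar : Fin L → ℝ
  SigmaBar : Fin L → ℝ

variable {L : ℕ} (m : Model L) (P : Protocol L) (s : OuterVars L)

/-- `E[Z[l]^2]`. -/
def varZ (l : Fin L) : ℝ := 1 / (L * m.δ l) * ∫ x, x ^ 2 ∂m.lawX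

/-- The joint law of `((Z[l], Z_t[l]), W[l])`: the pair is zero-mean Gaussian and independent
of `W[l]`. -/
def lawOuter (l : Fin L) : Measure (EuclideanSpace ℝ (Fin 2) × ℝ) :=
  (multivariateGaussian 0 !![varZ m l, s.zz l; s.zz l, s.z2 l]).prod (m.lawW l)

/-- `ξ_out[l] = E[∂₁ f_out(Z_t, Y; v)]` with `Y = g(Z, W)`. -/
def xiOut (l : Fin L) : ℝ :=
  ∫ p, deriv (fun θ => m.fOut l θ (m.g l (p.1 0) p.2) (s.v l)) (p.1 1) ∂lawOuter m s l

/-- `ζ[l] = - E[∂/∂z f_out(Z_t, g(z, W); v) at z = Z]`. -/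
def zeta (l : Fin L) : ℝ :=
  - ∫ p, deriv (fun z => m.fOut l (p.1 1) (m.g l z p.2) (s.v l)) (p.1 0) ∂lawOuter m s l

/-- `E[M_t[l]^2]` with `M_t = f_out(Z_t, Y; v)`. -/
def mSq (l : Fin L) : ℝ :=
  ∫ p, (m.fOut l (p.1 1) (m.g l (p.1 0) p.2) (s.v l)) ^ 2 ∂lawOuter m s l

/-- The joint law of `(H[l])_l`: independent zero-mean Gaussian with variances `E[M[l]^2] / L`. -/
def lawH : Measure (Fin L → ℝ) :=
  Measure.pi (fun l => gaussianReal 0 (mSq m s l / L).toNNReal)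

/-- The effective amplitude of `X` after aggregation by the protocol `P`. -/
def etaBar (l : Fin L) : ℝ := P (fun k => zeta m s k / xiOut m s k) l

/-- The effective noise after aggregation by the protocol `P`. -/
def HTilde (h : Fin L → ℝ) (l : Fin L) : ℝ := P (fun k => h k / xiOut m s k) l

/-- The effective noise power. -/
def SigmaBar (l : Fin L) : ℝ := ∫ h, (HTilde m P s h l) ^ 2 ∂lawH m s

/-- The effective signal-to-noise ratio before inner denoising. -/
def effectiveSNR (l : Fin L) : ℝ := (etaBar m P s l / L) ^ 2 / SigmaBar m P s l

/-- The input `(η̄ / L) X + H̃` of the inner denoiser, as a function of `(X, H)`. -/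
def innerInput (l : Fin L) (p : ℝ × (Fin L → ℝ)) : ℝ :=
  etaBar m P s l / L * p.1 + HTilde m P s p.2 l

/-- The variables produced by the inner module when node `l` uses the parameters `η l`
and `σ2 l`. -/
def innerModule (η σ2 : Fin L → ℝ) : OuterVars L where
  zz := fun l => 1 / (L * m.δ l) *
    ∫ p, p.1 * m.fIn l (innerInput m P s l p) (η l) (σ2 l) ∂(m.lawX.prod (lawH m s))
  z2 := fun l => 1 / (L * m.δ l) *
    ∫ p, (m.fIn l (innerInput m P s l p) (η l) (σ2 l)) ^ 2 ∂(m.lawX.prod (lawH m s))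
  v := fun l => σ2 l / (m.δ l * η l) *
    ∫ p, deriv (fun u => m.fIn l u (η l) (σ2 l)) (innerInput m P s l p)
      ∂(m.lawX.prod (lawH m s))

/-- The state of the recursion: the variables of the outer module and the memories used to
compute `η` and `σ²`. -/
structure State (aux : AuxRule L) where
  outer : OuterVars L
  memEta : aux.Mem
  memSigma : aux.Mem

/-- One iteration of state evolution for `T = 1`: `P` aggregates the signal estimates, and `aux`
computes `η` from the local values `1` and `L σ²` from the local values `1 / ξ_out`. -/
def step (aux : AuxRule L) (S : State aux) : State aux :=
  let one : Fin L → ℝ := fun _ => 1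
  let inv : Fin L → ℝ := fun k => 1 / xiOut m S.outer k
  let memEta' := aux.update one S.memEta
  let memSigma' := aux.update inv S.memSigma
  { outer := innerModule m P S.outer (aux.read one memEta')
      (fun l => 1 / L * aux.read inv memSigma' l)
    memEta := memEta'
    memSigma := memSigma' }

/-- The fixed points of the recursion, as tuples of variables. -/
def fixedPoints (aux : AuxRule L) : Set (Vars L) :=
  {x | ∃ S : State aux, step m P aux S = S ∧ x.toOuterVars = S.outer ∧
    x.etaBar = etaBar m P S.outer ∧ x.SigmaBar = SigmaBar m P S.outer}

/-- The fixed points for D-GAMP with the linear protocol. -/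
def linearFixedPoints (G : Digraph (Fin L)) (γ : ℝ) (aux : AuxRule L) : Set (Vars L) :=
  fixedPoints m (linearProtocol G γ) aux

/-- The fixed points for centralized GAMP, in which the signal estimates are summed over all
nodes, `η = L` and `σ² = L⁻¹ ∑ l, 1 / ξ_out[l]`. -/
def centralizedFixedPoints : Set (Vars L) :=
  fixedPoints m (sumProtocol L) (AuxRule.ofProtocol (sumProtocol L))

/-- The measurements and the denoisers are the same in all nodes. -/
def Homogeneous : Prop :=
  ∀ k l, m.δ k = m.δ l ∧ m.lawW k = m.lawW l ∧ m.g k = m.g l ∧ m.fOut k = m.fOut l ∧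
    m.fIn k = m.fIn l

/-- The effective signal and noise powers do not vanish. -/
def Vars.Nondegenerate (x : Vars L) : Prop := ∃ l, x.etaBar l ≠ 0 ∧ x.SigmaBar l ≠ 0

end DGAMP

end

noncomputable section

namespace DGAMP

/-! The linear protocol is multiplication by a matrix `weight` whose rows sum to 1, and centralized
aggregation is multiplication by the all-ones matrix. Given the outer variables, let b be the vector
of gains ζ/ξ and τ ≥ 0 the vector of noise powers E[M²]/(Lξ²). A protocol with matrix A yields
amplitudes Ab and, since the H[l] are independent, noise powers given by the entrywise square of A
applied to τ. The rule for η and σ² enters neither.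

Claim 1: a common fixed point has common b and τ, so every node would have to obtain ∑b and ∑τ. On a
balanced graph the columns of A also sum to 1, and adding the first condition over the nodes gives
L∑b = ∑b. With small degrees, the squared weights are at most 1 and are less than 1 off the
diagonal, so some node obtains less than ∑τ.

Claim 2: homogeneity makes b and τ constant. The SNR ratio is then 1/(L∑ₖ A[l,k]²), and ∑ₖ A[l,k]² ≥
1/L with equality only for a uniform row.

Claim 3: with constant b, an SNR nowhere below the centralized one bounds each node's noise by
∑τ/L². Adding over the nodes and using the same inequality for the columns forces every weight to be
1/L. -/

/-! ### The weight matrix and its row and column sums -/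

open Classical in
/-- The matrix of the linear protocol. -/
def weight {L : ℕ} (G : Digraph (Fin L)) (γ : ℝ) (l k : Fin L) : ℝ :=
  (if k = l then 1 - γ * ((inNbr G l).card : ℝ) else 0) + if G.Adj k l then γ else 0

theorem linearProtocol_apply {L : ℕ} (G : Digraph (Fin L)) (γ : ℝ) (x : Fin L → ℝ) (l : Fin L) :
    linearProtocol G γ x l = ∑ k, weight G γ l k * x k := by
  classical
  simp only [linearProtocol, weight, add_mul, Finset.sum_add_distrib, ite_mul, zero_mul,
    Finset.sum_ite_eq', Finset.mem_univ, if_true, Finset.sum_sub_distrib, Finset.sum_const,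
    nsmul_eq_mul]
  rw [← Finset.sum_filter, ← Finset.mul_sum]
  have : Finset.univ.filter (fun k => G.Adj k l) = inNbr G l := by
    ext; simp [inNbr]
  rw [this]
  ring

theorem sum_weight {L : ℕ} (G : Digraph (Fin L)) (γ : ℝ) (l : Fin L) :
    ∑ k, weight G γ l k = 1 := by
  have h := linearProtocol_apply G γ (fun _ => 1) l
  simpa [linearProtocol] using h.symm

/-- The diagonal entry loses γ times the in-degree, while the rest of the column contributes γ times
the out-degree; balance cancels the two. -/
theorem Balanced.sum_weight_left {L : ℕ} {G : Digraph (Fin L)} (hG : Balanced G) (γ : ℝ)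
    (k : Fin L) : ∑ l, weight G γ l k = 1 := by
  classical
  simp only [weight, Finset.sum_add_distrib, Finset.sum_ite_eq, Finset.mem_univ, if_true]
  rw [← Finset.sum_filter, Finset.sum_const, nsmul_eq_mul, hG k]
  have : Finset.univ.filter (fun l => G.Adj k l) = outNbr G k := by
    ext; simp [outNbr]
  rw [this]
  ring

theorem weight_of_ne {L : ℕ} (G : Digraph (Fin L)) [DecidableRel G.Adj] (γ : ℝ) {l k : Fin L}
    (h : k ≠ l) : weight G γ l k = if G.Adj k l then γ else 0 := by
  simp [weight, h]

/-- Decomposition around the mean 1/L: it gives both the Cauchy–Schwarz bound and its equality case,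
for rows and for columns. -/
theorem sum_sq_eq_add_sum_sub_sq {L : ℕ} (hL : 0 < L) {a : Fin L → ℝ} (ha : ∑ k, a k = 1) :
    ∑ k, a k ^ 2 = 1 / L + ∑ k, (a k - 1 / L) ^ 2 := by
  have hL' : (L : ℝ) ≠ 0 := by positivity
  have h : ∑ k, (a k - 1 / L) ^ 2 = ∑ k, (a k ^ 2 - 2 / L * a k + (1 / L) ^ 2) :=
    Finset.sum_congr rfl fun k _ => by ring
  rw [h, Finset.sum_add_distrib, Finset.sum_sub_distrib, ← Finset.mul_sum, ha]
  simp only [Finset.sum_const, Finset.card_univ, Fintype.card_fin, nsmul_eq_mul]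
  field_simp
  ring

theorem one_div_le_sum_sq {L : ℕ} (hL : 0 < L) {a : Fin L → ℝ} (ha : ∑ k, a k = 1) :
    1 / (L : ℝ) ≤ ∑ k, a k ^ 2 := by
  rw [sum_sq_eq_add_sum_sub_sq hL ha]
  have : 0 ≤ ∑ k, (a k - 1 / (L : ℝ)) ^ 2 := Finset.sum_nonneg fun _ _ => sq_nonneg _
  linarith

theorem sum_sq_eq_one_div_iff {L : ℕ} (hL : 0 < L) {a : Fin L → ℝ} (ha : ∑ k, a k = 1) :
    ∑ k, a k ^ 2 = 1 / (L : ℝ) ↔ ∀ k, a k = 1 / L := by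
  rw [sum_sq_eq_add_sum_sub_sq hL ha, add_eq_left,
    Finset.sum_eq_zero_iff_of_nonneg fun _ _ => sq_nonneg _]
  simp [sub_eq_zero]

theorem weight_eq_one_div_iff {L : ℕ} (hL : 2 ≤ L) (G : Digraph (Fin L)) (γ : ℝ)
    (l : Fin L) :
    (∀ k, weight G γ l k = 1 / L) ↔ γ = 1 / L ∧ ∀ k, k ≠ l → G.Adj k l := by
  classical
  have hL' : (0 : ℝ) < 1 / L := by positivity
  constructor
  · intro h
    have key : ∀ k, k ≠ l → G.Adj k l ∧ γ = 1 / L := by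
      intro k hk
      have := h k
      rw [weight_of_ne G γ hk] at this
      split_ifs at this with hadj
      · exact ⟨hadj, this⟩
      · exact absurd this hL'.ne
    have : Nontrivial (Fin L) := Fin.nontrivial_iff_two_le.mpr hL
    obtain ⟨k, hk⟩ := exists_ne l
    exact ⟨(key k hk).2, fun k hk => (key k hk).1⟩
  · rintro ⟨hγ, hadj⟩
    have off : ∀ k, k ≠ l → weight G γ l k = 1 / L := fun k hk => by
      rw [weight_of_ne G γ hk, if_pos (hadj k hk), hγ]
    intro k
    by_cases hk : k = l
    · subst hk
      -- The row sum 1 and the L - 1 off-diagonal entries 1/L determine the diagonal entry.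
      have hs := sum_weight G γ k
      rw [← Finset.add_sum_erase _ _ (Finset.mem_univ k),
        Finset.sum_congr rfl fun j hj => off j (Finset.ne_of_mem_erase hj)] at hs
      simp only [Finset.sum_const, Finset.card_erase_of_mem (Finset.mem_univ k),
        Finset.card_univ, Fintype.card_fin, nsmul_eq_mul] at hs
      rw [Nat.cast_sub (by omega), Nat.cast_one] at hs
      have : (L : ℝ) ≠ 0 := by positivity
      field_simp at hs ⊢
      linarith
    · exact off k hk

/-! ### Signal and noise powers after aggregation -/

/-- The mean is zero, so the second moment is the variance, and variances of independent terms add.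
-/
theorem integral_sq_sum_pi_gaussianReal {ι : Type*} [Fintype ι] (c : ι → ℝ) (v : ι → NNReal) :
    ∫ h, (∑ i, c i * h i) ^ 2 ∂(Measure.pi fun i => gaussianReal 0 (v i)) =
      ∑ i, c i ^ 2 * v i := by
  have hmem : ∀ i, MemLp (fun x : ℝ => c i * x) 2 (gaussianReal 0 (v i)) := fun i =>
    (memLp_id_gaussianReal 2).const_mul (c i)
  have hvar := variance_sum_pi hmem
  have hfun : (∑ i, fun h : ι → ℝ => c i * h i) = fun h => ∑ i, c i * h i := by
    ext h; simp
  rw [hfun, variance_of_integral_eq_zero (Measurable.aemeasurable (by fun_prop))] at hvar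
  · rw [hvar]
    refine Finset.sum_congr rfl fun i _ => ?_
    rw [variance_const_mul, variance_fun_id_gaussianReal]
  · rw [integral_finsetSum]
    · refine Finset.sum_eq_zero fun i _ => ?_
      rw [integral_comp_eval (X := fun _ : ι => ℝ) (i := i) (f := fun x : ℝ => c i * x)
        (hmem i).aestronglyMeasurable,
        integral_const_mul, integral_id_gaussianReal, mul_zero]
    · exact fun i _ => integrable_comp_eval (X := fun _ : ι => ℝ) (i := i)
        (f := fun x : ℝ => c i * x) ((hmem i).integrable (by norm_num))

section Powers

variable {L : ℕ} (m : Model L) (s : OuterVars L)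

/-- The local signal gain `ζ / ξ_out`. -/
def gain (k : Fin L) : ℝ := zeta m s k / xiOut m s k

/-- The noise power `E[M²] / (L ξ_out²)` of a node before aggregation. -/
def noisePower (k : Fin L) : ℝ := mSq m s k / L / xiOut m s k ^ 2

theorem mSq_nonneg (k : Fin L) : 0 ≤ mSq m s k := integral_nonneg fun _ => sq_nonneg _

theorem noisePower_nonneg (k : Fin L) : 0 ≤ noisePower m s k :=
  div_nonneg (div_nonneg (mSq_nonneg m s k) (Nat.cast_nonneg L)) (sq_nonneg _)

theorem SigmaBar_eq_of_apply {P : Protocol L} {l : Fin L} {a : Fin L → ℝ}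
    (hP : ∀ x, P x l = ∑ k, a k * x k) :
    SigmaBar m P s l = ∑ k, a k ^ 2 * noisePower m s k := by
  have h : ∀ h : Fin L → ℝ, HTilde m P s h l = ∑ k, a k / xiOut m s k * h k := fun h => by
    rw [HTilde, hP]
    exact Finset.sum_congr rfl fun k _ => by ring
  simp only [SigmaBar, h, lawH]
  rw [integral_sq_sum_pi_gaussianReal]
  refine Finset.sum_congr rfl fun k _ => ?_
  -- The truncation `toNNReal` in `lawH` is harmless because the variance is nonnegative.
  rw [Real.coe_toNNReal _ (div_nonneg (mSq_nonneg m s k) (Nat.cast_nonneg L)), noisePower]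
  ring

theorem SigmaBar_linearProtocol (G : Digraph (Fin L)) (γ : ℝ) (l : Fin L) :
    SigmaBar m (linearProtocol G γ) s l = ∑ k, weight G γ l k ^ 2 * noisePower m s k :=
  SigmaBar_eq_of_apply m s fun x => linearProtocol_apply G γ x l

theorem SigmaBar_sumProtocol (l : Fin L) :
    SigmaBar m (sumProtocol L) s l = ∑ k, noisePower m s k := by
  rw [SigmaBar_eq_of_apply m s (a := fun _ => 1) fun x => by simp [sumProtocol]]
  simp

theorem etaBar_linearProtocol (G : Digraph (Fin L)) (γ : ℝ) (l : Fin L) :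
    etaBar m (linearProtocol G γ) s l = ∑ k, weight G γ l k * gain m s k :=
  linearProtocol_apply G γ _ l

theorem etaBar_sumProtocol (l : Fin L) :
    etaBar m (sumProtocol L) s l = ∑ k, gain m s k := rfl

variable {m} {s}

theorem etaBar_linearProtocol_of_gain_eq {b : ℝ} (hb : ∀ k, gain m s k = b)
    (G : Digraph (Fin L)) (γ : ℝ) (l : Fin L) : etaBar m (linearProtocol G γ) s l = b := by
  simp only [etaBar_linearProtocol, hb, ← Finset.sum_mul, sum_weight, one_mul]

theorem etaBar_sumProtocol_of_gain_eq {b : ℝ} (hb : ∀ k, gain m s k = b) (l : Fin L) :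
    etaBar m (sumProtocol L) s l = L * b := by
  simp [etaBar_sumProtocol, hb]

end Powers

/-! ### Disjointness of the fixed points -/

variable {L : ℕ} {m : Model L}

/-- Centralized aggregation gives every node the same totals, so nondegeneracy at one node is a
condition on these totals. -/
theorem sum_gain_ne_zero_and_sum_noisePower_ne_zero {y : Vars L}
    (hy : y ∈ centralizedFixedPoints m) (hn : y.Nondegenerate) :
    ∑ k, gain m y.toOuterVars k ≠ 0 ∧ ∑ k, noisePower m y.toOuterVars k ≠ 0 := by
  obtain ⟨S, -, h1, h2, h3⟩ := hy
  obtain ⟨l, hl1, hl2⟩ := hn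
  rw [h2, ← h1, etaBar_sumProtocol] at hl1
  rw [h3, ← h1, SigmaBar_sumProtocol] at hl2
  exact ⟨hl1, hl2⟩

theorem linearFixedPoint_ne_centralizedFixedPoint (hL : 2 ≤ L) {G : Digraph (Fin L)}
    (hG : ∀ l, ¬ G.Adj l l) {γ : ℝ} (hγ : 0 < γ)
    (hbal : Balanced G ∨ ∀ l, γ * ((inNbr G l).card : ℝ) < 1) {aux : AuxRule L} {x y : Vars L}
    (hx : x ∈ linearFixedPoints m G γ aux) (hy : y ∈ centralizedFixedPoints m)
    (hn : y.Nondegenerate) : x ≠ y := by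
  classical
  rintro rfl
  obtain ⟨hB, hT⟩ := sum_gain_ne_zero_and_sum_noisePower_ne_zero hy hn
  obtain ⟨S, -, h1, h2, h3⟩ := hx
  obtain ⟨S', -, h1', h2', h3'⟩ := hy
  rw [← h1] at h2 h3
  rw [← h1'] at h2' h3'
  generalize x.toOuterVars = s at *
  have heta : ∀ l, ∑ k, weight G γ l k * gain m s k = ∑ k, gain m s k := fun l => by
    rw [← etaBar_linearProtocol, ← etaBar_sumProtocol m s l, ← h2, h2']
  have hsig : ∀ l, ∑ k, weight G γ l k ^ 2 * noisePower m s k = ∑ k, noisePower m s k :=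
    fun l => by rw [← SigmaBar_linearProtocol, ← SigmaBar_sumProtocol m s l, ← h3, h3']
  rcases hbal with hbal | hdeg
  · have hsum : ∑ l, ∑ k, weight G γ l k * gain m s k = ∑ k, gain m s k := by
      rw [Finset.sum_comm]
      exact Finset.sum_congr rfl fun k _ => by
        rw [← Finset.sum_mul, hbal.sum_weight_left, one_mul]
    simp only [heta, Finset.sum_const, Finset.card_univ, Fintype.card_fin, nsmul_eq_mul] at hsum
    have hL1 : (L : ℝ) = 1 := mul_right_cancel₀ hB (by rw [hsum, one_mul])
    have : L = 1 := by exact_mod_cast hL1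
    omega
  -- A node with an incoming edge has in-degree at least 1, so the degree condition gives γ < 1
  -- there.
  · have hγ1 : ∀ k l, G.Adj k l → γ * 1 ≤ γ * ((inNbr G l).card : ℝ) := fun k l h => by
      refine mul_le_mul_of_nonneg_left ?_ hγ.le
      have : 0 < (inNbr G l).card := Finset.card_pos.mpr ⟨k, by simpa [inNbr] using h⟩
      exact_mod_cast this
    have hoff : ∀ k l, k ≠ l → weight G γ l k ^ 2 < 1 := fun k l hk => by
      rw [weight_of_ne G γ hk]
      split_ifs with hadj
      · have := hγ1 k l hadj
        have := hdeg l
        nlinarith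
      · norm_num
    have hle : ∀ k l, weight G γ l k ^ 2 ≤ 1 := fun k l => by
      by_cases hk : k = l
      · subst hk
        have h0 : 0 ≤ γ * ((inNbr G k).card : ℝ) := by positivity
        have := hdeg k
        simp only [weight, if_true, if_neg (hG k), add_zero]
        nlinarith
      · exact (hoff k l hk).le
    obtain ⟨k, -, hk⟩ := Finset.exists_ne_zero_of_sum_ne_zero hT
    have hkpos : 0 < noisePower m s k := lt_of_le_of_ne (noisePower_nonneg m s k) hk.symm
    have : Nontrivial (Fin L) := Fin.nontrivial_iff_two_le.mpr hL
    -- Any node other than `k` works: it receives the positive noise power of `k` through an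
    -- off-diagonal weight, hence strictly reduced.
    obtain ⟨l, hl⟩ := exists_ne k
    refine absurd (hsig l) (ne_of_lt (Finset.sum_lt_sum (fun j _ => ?_) ⟨k, Finset.mem_univ k, ?_⟩))
    · exact mul_le_of_le_one_left (noisePower_nonneg m s j) (hle j l)
    · exact mul_lt_of_lt_one_left hkpos (hoff k l hl.symm)

/-! ### Homogeneous measurements -/

/-- At a centralized fixed point of a homogeneous model all nodes have the same variables. -/
theorem Homogeneous.outerVars_eq (hm : Homogeneous m) {y : Vars L}
    (hy : y ∈ centralizedFixedPoints m) (k l : Fin L) :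
    y.zz k = y.zz l ∧ y.z2 k = y.z2 l ∧ y.v k = y.v l := by
  obtain ⟨S, hS, h1, -, -⟩ := hy
  obtain ⟨hδ, -, -, -, hf⟩ := hm k l
  -- By stationarity the outer variables are an output of the inner module, whose input and
  -- parameters are the same at all nodes under centralized aggregation.
  have hout := h1.trans (congrArg State.outer hS).symm
  have hzz := congrArg OuterVars.zz hout
  have hz2 := congrArg OuterVars.z2 hout
  have hv := congrArg OuterVars.v hout
  simp only [step, innerModule] at hzz hz2 hv
  have hu : ∀ p, innerInput m (sumProtocol L) S.outer k p =
    innerInput m (sumProtocol L) S.outer l p := fun p => rfl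
  rw [hzz, hz2, hv]
  simp only [AuxRule.ofProtocol, sumProtocol] at hu ⊢
  refine ⟨?_, ?_, ?_⟩ <;> simp only [hδ, hf, hu]

theorem Homogeneous.gain_eq_and_noisePower_eq (hm : Homogeneous m) {y : Vars L}
    (hy : y ∈ centralizedFixedPoints m) (k l : Fin L) :
    gain m y.toOuterVars k = gain m y.toOuterVars l ∧
      noisePower m y.toOuterVars k = noisePower m y.toOuterVars l := by
  obtain ⟨hδ, hW, hg, hf, -⟩ := hm k l
  obtain ⟨hzz, hz2, hv⟩ := hm.outerVars_eq hy k l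
  have hlaw : lawOuter m y.toOuterVars k = lawOuter m y.toOuterVars l := by
    simp only [lawOuter, varZ, hδ, hW, hzz, hz2]
  constructor
  · simp only [gain, zeta, xiOut, hlaw, hg, hf, hv]
  · simp only [noisePower, mSq, xiOut, hlaw, hg, hf, hv]

theorem Homogeneous.effectiveSNR_le_and_eq_iff (hL : 2 ≤ L) (hm : Homogeneous m)
    (G : Digraph (Fin L)) (γ : ℝ) {y : Vars L}
    (hy : y ∈ centralizedFixedPoints m) (hn : y.Nondegenerate) (l : Fin L) :
    effectiveSNR m (linearProtocol G γ) y.toOuterVars l ≤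
        effectiveSNR m (sumProtocol L) y.toOuterVars l ∧
      (effectiveSNR m (linearProtocol G γ) y.toOuterVars l =
          effectiveSNR m (sumProtocol L) y.toOuterVars l ↔
        γ = 1 / L ∧ ∀ k, k ≠ l → G.Adj k l) := by
  obtain ⟨hB, hT⟩ := sum_gain_ne_zero_and_sum_noisePower_ne_zero hy hn
  have hb := fun k => (hm.gain_eq_and_noisePower_eq hy k l).1
  have ht := fun k => (hm.gain_eq_and_noisePower_eq hy k l).2
  have ht0 := noisePower_nonneg m y.toOuterVars l
  rw [effectiveSNR, effectiveSNR, etaBar_linearProtocol_of_gain_eq hb,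
    etaBar_sumProtocol_of_gain_eq hb, SigmaBar_linearProtocol, SigmaBar_sumProtocol]
  simp only [hb, ht, ← Finset.sum_mul, Finset.sum_const, Finset.card_univ, Fintype.card_fin,
    nsmul_eq_mul] at hB hT ⊢
  have hL0 : 0 < L := by omega
  have hLpos : (0 : ℝ) < L := by exact_mod_cast hL0
  have hb0 := right_ne_zero_of_mul hB
  have htpos := lt_of_le_of_ne ht0 (right_ne_zero_of_mul hT).symm
  rw [← weight_eq_one_div_iff hL G γ l, ← sum_sq_eq_one_div_iff hL0 (sum_weight G γ l)]
  have hge := one_div_le_sum_sq hL0 (sum_weight G γ l)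
  generalize gain m y.toOuterVars l = b at *
  generalize noisePower m y.toOuterVars l = t at *
  generalize ∑ k, weight G γ l k ^ 2 = A at *
  have hApos : 0 < A := lt_of_lt_of_le (by positivity) hge
  -- The SNR gap is a positive multiple of `A - 1 / L`, so the inequality and its equality case both
  -- follow from this factor.
  have hdiff : (L * b / L) ^ 2 / (L * t) - (b / L) ^ 2 / (A * t) =
      b ^ 2 / (L * t * A) * (A - 1 / L) := by
    field_simp
  have hc : 0 < b ^ 2 / (L * t * A) := by positivity
  constructor
  · have := mul_nonneg hc.le (sub_nonneg.mpr hge)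
    linarith
  · constructor
    · intro h
      rw [h, sub_self] at hdiff
      have := (mul_eq_zero.mp hdiff.symm).resolve_left hc.ne'
      linarith
    · intro h
      rw [h, sub_self, mul_zero] at hdiff
      rw [h]
      linarith

/-! ### Heterogeneous measurements with equal gains -/

theorem exists_effectiveSNR_lt_of_gain_eq (hL : 2 ≤ L) {G : Digraph (Fin L)}
    {γ : ℝ} (hbal : Balanced G) {y : Vars L}
    (hy : y ∈ centralizedFixedPoints m) (hn : y.Nondegenerate)
    (hgain : ∀ k l, gain m y.toOuterVars k = gain m y.toOuterVars l)
    (hM : ∀ l, 0 < mSq m y.toOuterVars l)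
    (hne : ¬ (γ = 1 / L ∧ ∀ k l, k ≠ l → G.Adj k l)) :
    ∃ l, effectiveSNR m (linearProtocol G γ) y.toOuterVars l <
      effectiveSNR m (sumProtocol L) y.toOuterVars l := by
  obtain ⟨hB, -⟩ := sum_gain_ne_zero_and_sum_noisePower_ne_zero hy hn
  generalize y.toOuterVars = s at *
  have hL0 : 0 < L := by omega
  have hLpos : (0 : ℝ) < L := by exact_mod_cast hL0
  obtain ⟨b, hb⟩ : ∃ b, ∀ k, gain m s k = b := ⟨gain m s ⟨0, hL0⟩, fun k => hgain k _⟩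
  have hb0 : b ≠ 0 := by
    rintro rfl
    simp [hb] at hB
  have hτ : ∀ k, 0 < noisePower m s k := fun k => by
    -- Division by zero yields 0, so a vanishing `xiOut` would make the common gain `b` vanish.
    have hxi : xiOut m s k ≠ 0 := by
      intro h
      apply hb0
      rw [← hb k, gain, h, div_zero]
    have := hM k
    unfold noisePower
    positivity
  have hSpos : ∀ l, 0 < ∑ k, weight G γ l k ^ 2 * noisePower m s k := fun l => by
    obtain ⟨k, -, hk⟩ := Finset.exists_ne_zero_of_sum_ne_zero
      (show ∑ k, weight G γ l k ≠ 0 by rw [sum_weight]; exact one_ne_zero)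
    exact Finset.sum_pos' (fun j _ => mul_nonneg (sq_nonneg _) (hτ j).le)
      ⟨k, Finset.mem_univ k, mul_pos (by positivity) (hτ k)⟩
  have hTpos : 0 < ∑ k, noisePower m s k :=
    Finset.sum_pos (fun k _ => hτ k) ⟨⟨0, hL0⟩, Finset.mem_univ _⟩
  by_contra! hcon
  -- The factor 1/L² appears because the centralized amplitude is `L * b` and the linear one is `b`.
  have hle : ∀ l, ∑ k, weight G γ l k ^ 2 * noisePower m s k ≤
      1 / (L : ℝ) ^ 2 * ∑ k, noisePower m s k := fun l => by
    have h := hcon l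
    rw [effectiveSNR, effectiveSNR, etaBar_linearProtocol_of_gain_eq hb,
      etaBar_sumProtocol_of_gain_eq hb, SigmaBar_linearProtocol, SigmaBar_sumProtocol,
      div_le_div_iff₀ hTpos (hSpos l), mul_div_cancel_left₀ _ hLpos.ne'] at h
    refine le_of_mul_le_mul_left (h.trans_eq ?_) (show 0 < b ^ 2 by positivity)
    ring
  have hlow : ∀ k, 1 / (L : ℝ) * noisePower m s k ≤
      (∑ l, weight G γ l k ^ 2) * noisePower m s k := fun k =>
    mul_le_mul_of_nonneg_right (one_div_le_sum_sq hL0 (hbal.sum_weight_left γ k)) (hτ k).le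
  -- Adding `hle` over the L nodes gives the reverse of the sum of `hlow`, so every column attains
  -- equality in Cauchy–Schwarz.
  have hsum : ∑ k, (∑ l, weight G γ l k ^ 2) * noisePower m s k ≤
      ∑ k, 1 / (L : ℝ) * noisePower m s k := by
    simp only [Finset.sum_mul]
    rw [Finset.sum_comm]
    refine (Finset.sum_le_sum fun l _ => hle l).trans_eq ?_
    rw [Finset.sum_const, Finset.card_univ, Fintype.card_fin, nsmul_eq_mul, ← Finset.mul_sum,
      ← mul_assoc]
    congr 1
    field_simp
  have heq := (Finset.sum_eq_sum_iff_of_le fun k _ => hlow k).mp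
    (le_antisymm (Finset.sum_le_sum fun k _ => hlow k) hsum)
  have hw : ∀ l k, weight G γ l k = 1 / L := fun l k =>
    (sum_sq_eq_one_div_iff hL0 (hbal.sum_weight_left γ k)).mp
      (mul_right_cancel₀ (hτ k).ne' (heq k (Finset.mem_univ k))).symm l
  have h := fun l => (weight_eq_one_div_iff hL G γ l).mp (hw l)
  exact hne ⟨(h ⟨0, hL0⟩).1, fun k l hkl => (h l).2 k hkl⟩

end DGAMP

end

theorem mainTheorem6 (L : ℕ) (hL : 2 ≤ L) (m : DGAMP.Model L) (G : Digraph (Fin L))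
    (hG : ∀ l, ¬ G.Adj l l) (γ : ℝ) (hγ : 0 < γ) :
    -- no nondegenerate centralized fixed point is a fixed point with the linear protocol
    ((DGAMP.Balanced G ∨ ∀ l, γ * ((DGAMP.inNbr G l).card : ℝ) < 1) →
      ∀ aux : DGAMP.AuxRule L, ∀ x ∈ DGAMP.linearFixedPoints m G γ aux,
        ∀ y ∈ DGAMP.centralizedFixedPoints m, y.Nondegenerate → x ≠ y) ∧
    -- for homogeneous measurements the centralized effective SNR is missed in every node
    (DGAMP.Homogeneous m →
      ∀ y ∈ DGAMP.centralizedFixedPoints m, y.Nondegenerate → ∀ l,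
        DGAMP.effectiveSNR m (DGAMP.linearProtocol G γ) y.toOuterVars l ≤
            DGAMP.effectiveSNR m (DGAMP.sumProtocol L) y.toOuterVars l ∧
          (DGAMP.effectiveSNR m (DGAMP.linearProtocol G γ) y.toOuterVars l =
              DGAMP.effectiveSNR m (DGAMP.sumProtocol L) y.toOuterVars l ↔
            γ = 1 / L ∧ ∀ k, k ≠ l → G.Adj k l)) ∧
    -- for heterogeneous measurements with equal gains it is missed in some node
    (DGAMP.Balanced G →
      ∀ y ∈ DGAMP.centralizedFixedPoints m, y.Nondegenerate →
        (∀ k l, DGAMP.zeta m y.toOuterVars k / DGAMP.xiOut m y.toOuterVars k =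
          DGAMP.zeta m y.toOuterVars l / DGAMP.xiOut m y.toOuterVars l) →
        (∀ l, 0 < DGAMP.mSq m y.toOuterVars l) →
        ¬ (γ = 1 / L ∧ ∀ k l, k ≠ l → G.Adj k l) →
        ∃ l, DGAMP.effectiveSNR m (DGAMP.linearProtocol G γ) y.toOuterVars l <
          DGAMP.effectiveSNR m (DGAMP.sumProtocol L) y.toOuterVars l) := by
  refine ⟨fun hbal aux x hx y hy hn => ?_, fun hm y hy hn l => ?_, fun hbal y hy hn hg hM hne => ?_⟩
  · exact DGAMP.linearFixedPoint_ne_centralizedFixedPoint hL hG hγ hbal hx hy hn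
  · exact hm.effectiveSNR_le_and_eq_iff hL G γ hy hn l
  · exact DGAMP.exists_effectiveSNR_lt_of_gain_eq hL hbal hy hn hg hM hne
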